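/- Let $s>0$ and let $\mathcal P=\mathbb R[S_1,S_2,S_3]/(S_1^2+S_2^2+S_3^2-s^2)$ be the algebra of polynomials in the components of the spin vector on the sphere $S^2$ of radius $s$, equipped with the Poisson bracket $$\{f,g\}=\sum_{i,j,k=1}^3\epsilon_{ijk}\,S_i\,\frac{\partial f}{\partial S_j}\,\frac{\partial g}{\partial S_k},$$ and let $\mathcal P^1\subset\mathcal P$ be the subspace of polynomials of degree at most $1$, i.e. the span of $1,S_1,S_2,S_3$. An admissible quantization of $(\mathcal P,\mathcal P^1)$ is a real-linear map $\mathcal Q$ from $\mathcal P$ to the (bounded) self-adjoint operators on a complex Hilbert space $H$ such that $\mathcal Q(\{f,g\})=-\mathrm i\,[\mathcal Q(f),\mathcal Q(g)]$ for all $f,g\in\mathcal P$, $\mathcal Q(1)=I$, and $\mathcal Q$ is irreducible on $\mathcal P^1$: $H\neq 0$, and the only closed subspaces of $H$ invariant under all $\mathcal Q(f)$, $f\in\mathcal P^1$, are $0$ and $H$. If $\mathcal Q$ is an admissible quantization of $(\mathcal P,\mathcal P^1)$, then there are real constants $a,c$ with $a^2+c^2\neq 0$ such that $$\mathcal Q(S_i^2)=a\,\mathcal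 Q(S_i)^2+cI\qquad(i=1,2,3),$$ and, for the same $a$ and all $i\neq\ell$ in $\{1,2,3\}$, $$\mathcal Q(S_iS_\ell)=\frac a2\bigl(\mathcal Q(S_i)\mathcal Q(S_\ell)+\mathcal Q(S_\ell)\mathcal Q(S_i)\bigr).$$ -/

import Mathlib

noncomputable section

namespace SpinSphere

open MvPolynomial

/-- The Levi-Civita symbol `ε i j k`; index arithmetic is modulo 3. -/
def eps (i j k : Fin 3) : ℝ :=
  if j = i + 1 ∧ k = i + 2 then 1 else if j = i + 2 ∧ k = i + 1 then -1 else 0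

/-- The expression `∑ ε i j k S_i (∂f/∂S_j) (∂g/∂S_k)` for polynomials in three variables. -/
def preBracket (f g : MvPolynomial (Fin 3) ℝ) : MvPolynomial (Fin 3) ℝ :=
  ∑ i, ∑ j, ∑ k, C (eps i j k) * X i * pderiv j f * pderiv k g

/-- The polynomial `S_1² + S_2² + S_3² - s²` that cuts out the sphere of radius `s`. -/
def sphereRel (s : ℝ) : MvPolynomial (Fin 3) ℝ :=
  ∑ i, X i ^ 2 - C (s ^ 2)

/-- The ideal generated by the sphere relation. -/
abbrev sphereIdeal (s : ℝ) : Ideal (MvPolynomial (Fin 3) ℝ) :=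
  Ideal.span {sphereRel s}

/-- The algebra `𝒫` of real polynomials in `S_1, S_2, S_3` modulo `S_1² + S_2² + S_3² = s²`. -/
abbrev Poly (s : ℝ) : Type :=
  MvPolynomial (Fin 3) ℝ ⧸ sphereIdeal s

theorem preBracket_sub_left (f f' g : MvPolynomial (Fin 3) ℝ) :
    preBracket (f - f') g = preBracket f g - preBracket f' g := by
  simp only [preBracket, map_sub, mul_sub, sub_mul, Finset.sum_sub_distrib]

theorem preBracket_sub_right (f g g' : MvPolynomial (Fin 3) ℝ) :
    preBracket f (g - g') = preBracket f g - preBracket f g' := by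
  simp only [preBracket, map_sub, mul_sub, Finset.sum_sub_distrib]

theorem preBracket_eq (f g : MvPolynomial (Fin 3) ℝ) :
    preBracket f g =
      X 0 * (pderiv 1 f * pderiv 2 g - pderiv 2 f * pderiv 1 g)
      + X 1 * (pderiv 2 f * pderiv 0 g - pderiv 0 f * pderiv 2 g)
      + X 2 * (pderiv 0 f * pderiv 1 g - pderiv 1 f * pderiv 0 g) := by
  simp only [preBracket, Fin.sum_univ_three, eps]
  simp
  ring

theorem preBracket_skew (f g : MvPolynomial (Fin 3) ℝ) :
    preBracket f g = -preBracket g f := by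
  rw [preBracket_eq, preBracket_eq]; ring

theorem preBracket_sphereRel_mul (s : ℝ) (h g : MvPolynomial (Fin 3) ℝ) :
    preBracket (sphereRel s * h) g = sphereRel s * preBracket h g := by
  rw [preBracket_eq, preBracket_eq]
  have h0 : pderiv 0 (sphereRel s) = 2 * X 0 := by
    simp [sphereRel, Fin.sum_univ_three, Derivation.leibniz_pow, pderiv_X]
  have h1 : pderiv 1 (sphereRel s) = 2 * X 1 := by
    simp [sphereRel, Fin.sum_univ_three, Derivation.leibniz_pow, pderiv_X]
  have h2 : pderiv 2 (sphereRel s) = 2 * X 2 := by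
    simp [sphereRel, Fin.sum_univ_three, Derivation.leibniz_pow, pderiv_X]
  simp only [pderiv_mul, h0, h1, h2]
  ring

theorem preBracket_mem_left (s : ℝ) {f : MvPolynomial (Fin 3) ℝ} (hf : f ∈ sphereIdeal s)
    (g : MvPolynomial (Fin 3) ℝ) : preBracket f g ∈ sphereIdeal s := by
  obtain ⟨h, rfl⟩ := Ideal.mem_span_singleton.1 hf
  rw [preBracket_sphereRel_mul]
  exact Ideal.mem_span_singleton.2 (dvd_mul_right _ _)

theorem preBracket_mem_right (s : ℝ) (f : MvPolynomial (Fin 3) ℝ) {g : MvPolynomial (Fin 3) ℝ}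
    (hg : g ∈ sphereIdeal s) : preBracket f g ∈ sphereIdeal s := by
  rw [preBracket_skew]
  exact neg_mem (preBracket_mem_left s hg f)

theorem preBracket_congr (s : ℝ) (f f' g g' : MvPolynomial (Fin 3) ℝ)
    (hf : f - f' ∈ sphereIdeal s) (hg : g - g' ∈ sphereIdeal s) :
    preBracket f g - preBracket f' g' ∈ sphereIdeal s := by
  have h : preBracket f g - preBracket f' g' =
      preBracket (f - f') g + preBracket f' (g - g') := by
    rw [preBracket_sub_left, preBracket_sub_right]; ring
  rw [h]
  exact add_mem (preBracket_mem_left s hf g) (preBracket_mem_right s f' hg)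

/-- The Poisson bracket on `𝒫`: the class of `∑ ε i j k S_i (∂f/∂S_j) (∂g/∂S_k)`. -/
def poisson {s : ℝ} (p q : Poly s) : Poly s :=
  Quotient.liftOn₂' p q
    (fun f g => Ideal.Quotient.mk (sphereIdeal s) (preBracket f g))
    (fun f g f' g' hf hg => Ideal.Quotient.eq.2
      (preBracket_congr s f f' g g'
        ((Submodule.quotientRel_def _).1 hf) ((Submodule.quotientRel_def _).1 hg)))

theorem poisson_mk {s : ℝ} (f g : MvPolynomial (Fin 3) ℝ) :
    poisson (Ideal.Quotient.mk (sphereIdeal s) f) (Ideal.Quotient.mk (sphereIdeal s) g)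
      = Ideal.Quotient.mk (sphereIdeal s) (preBracket f g) := rfl

/-- The component `S_i` of the spin vector, as an element of `𝒫`. -/
def S {s : ℝ} (i : Fin 3) : Poly s :=
  Ideal.Quotient.mk (sphereIdeal s) (X i)

/-- The subspace `𝒫^k` of classes with a polynomial representative of degree at most `k`. -/
def degLE (s : ℝ) (k : ℕ) : Submodule ℝ (Poly s) :=
  (restrictTotalDegree (Fin 3) ℝ k).map (Ideal.Quotient.mkₐ ℝ (sphereIdeal s)).toLinearMap

section Quantization

variable {s : ℝ} {H : Type*} [NormedAddCommGroup H] [InnerProductSpace ℂ H] [CompleteSpace H]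

/-- A quantization of `𝒫`: a real-linear map to (bounded) self-adjoint operators on a complex
Hilbert space with `𝒬({f, g}) = -i [𝒬(f), 𝒬(g)]` and `𝒬(1) = I`. -/
structure IsQuantization (Q : Poly s →ₗ[ℝ] (H →L[ℂ] H)) : Prop where
  isSelfAdjoint : ∀ f, IsSelfAdjoint (Q f)
  map_poisson : ∀ f g, Q (poisson f g) = (-Complex.I) • (Q f * Q g - Q g * Q f)
  map_one : Q 1 = 1

/-- `𝒬` is irreducible on `B`: the Hilbert space is nonzero, and its only closed subspaces that
are invariant under all `𝒬(f)`, `f ∈ B`, are zero and the whole space. -/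
structure IsIrreducibleOn (Q : Poly s →ₗ[ℝ] (H →L[ℂ] H)) (B : Submodule ℝ (Poly s)) : Prop where
  nontrivial : Nontrivial H
  eq_bot_or_eq_top : ∀ K : Submodule ℂ H, IsClosed (K : Set H) →
    (∀ f ∈ B, ∀ x ∈ K, Q f x ∈ K) → K = ⊥ ∨ K = ⊤

/-- An admissible quantization of `(𝒫, B)`. -/
structure IsAdmissibleQuantization (Q : Poly s →ₗ[ℝ] (H →L[ℂ] H))
    (B : Submodule ℝ (Poly s)) : Prop extends IsQuantization Q, IsIrreducibleOn Q B

end Quantization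

end SpinSphere

end

/-! The operators `J i = Q (S i)` satisfy the spin commutation relations, and `Q (S i * S l)` is a
symmetric rank-two tensor under them. Its highest component `T` commutes with the raising operator
`R` and has weight 2. In an irreducible representation this forces `T = a • R ^ 2`
(`IsLadder.exists_eq_smul_pow`), and `R ^ 2` is the highest component of the symmetrised product of
the `J i`. The difference of the two tensors has highest component zero, hence is a multiple of the
Kronecker delta (`IsTensor.eq_zero_of_highest`).

Self-adjointness makes `a` real. The sphere relation fixes the trace, and the Casimir operator is a
scalar by the weight 0 case of the same lemma; together they give `c`. Finite dimension is not
assumed: boundedness makes the ladder operators nilpotent, which yields a lowest weight vector. -/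

namespace SpinSphere

open MvPolynomial

/-! ### Ladder operators and lowest weight vectors -/

section Ladder

variable {H : Type*} [NormedAddCommGroup H] [InnerProductSpace ℂ H]

/-- In a normed algebra, an eigenvector of a commutator map with nonzero eigenvalue is
nilpotent. -/
theorem isNilpotent_of_commutator {A : Type*} [NormedRing A] [NormedAlgebra ℂ A] {Z R : A} {c : ℂ}
    (hc : c ≠ 0) (h : Z * R - R * Z = c • R) : IsNilpotent R := by
  -- The eigenvalue of `R ^ n` grows linearly in `n`, while the commutator map with `Z` has norm at
  -- most `2 * ‖Z‖`; so some power must vanish.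
  have key : ∀ n : ℕ, Z * R ^ n - R ^ n * Z = ((n : ℂ) * c) • R ^ n := by
    intro n
    induction n with
    | zero => simp
    | succ n ih =>
      have e : Z * R ^ (n + 1) - R ^ (n + 1) * Z
          = (Z * R ^ n - R ^ n * Z) * R + R ^ n * (Z * R - R * Z) := by
        rw [pow_succ]; noncomm_ring
      rw [e, ih, h, smul_mul_assoc, mul_smul_comm, ← pow_succ, ← add_smul]
      push_cast
      ring_nf
  obtain ⟨n, hn⟩ := exists_nat_gt (2 * ‖Z‖ / ‖c‖)
  refine ⟨n, ?_⟩
  by_contra hR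
  have hpos : 0 < ‖R ^ n‖ := norm_pos_iff.2 hR
  have h1 : ‖((n : ℂ) * c) • R ^ n‖ ≤ 2 * ‖Z‖ * ‖R ^ n‖ := by
    rw [← key n]
    calc ‖Z * R ^ n - R ^ n * Z‖ ≤ ‖Z * R ^ n‖ + ‖R ^ n * Z‖ := norm_sub_le _ _
      _ ≤ ‖Z‖ * ‖R ^ n‖ + ‖R ^ n‖ * ‖Z‖ := add_le_add (norm_mul_le _ _) (norm_mul_le _ _)
      _ = 2 * ‖Z‖ * ‖R ^ n‖ := by ring
  rw [norm_smul, norm_mul, Complex.norm_natCast] at h1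
  have h2 := le_of_mul_le_mul_right h1 hpos
  rw [div_lt_iff₀ (norm_pos_iff.2 hc)] at hn
  linarith

theorem exists_ne_zero_apply_eq_zero_of_isNilpotent [Nontrivial H] {L : H →L[ℂ] H}
    (h : IsNilpotent L) : ∃ v : H, v ≠ 0 ∧ L v = 0 := by
  by_contra! hv
  obtain ⟨n, hn⟩ := h
  have hne : ∀ n : ℕ, ∀ v : H, v ≠ 0 → (L ^ n) v ≠ 0 := by
    intro n
    induction n with
    | zero => intro v hv; simpa using hv
    | succ n ih => intro v h0; rw [pow_succ]; exact ih _ fun h => hv v h0 h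
  obtain ⟨v, h0⟩ := exists_ne (0 : H)
  exact hne n v h0 (by rw [hn]; rfl)

/-- A triple of bounded operators with the commutation relations of the ladder operators of
`𝔰𝔲(2)`. -/
structure IsLadder (Z R L : H →L[ℂ] H) : Prop where
  raise : Z * R - R * Z = R
  lower : Z * L - L * Z = -L
  comm : L * R - R * L = (-2 : ℂ) • Z

namespace IsLadder

variable {Z R L : H →L[ℂ] H}

theorem weight_apply_pow (h : IsLadder Z R L) (n : ℕ) (v : H) :
    Z ((R ^ n) v) = (R ^ n) (Z v) + (n : ℂ) • (R ^ n) v := by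
  induction n generalizing v with
  | zero => simp
  | succ n ih =>
    have e : Z (R v) = R (Z v) + R v := by
      have := DFunLike.congr_fun h.raise v
      simp only [sub_apply, mul_apply_eq_comp] at this
      rw [sub_eq_iff_eq_add] at this
      rw [this, add_comm]
    rw [pow_succ, mul_apply_eq_comp, ih, e, mul_apply_eq_comp, map_add]
    push_cast
    module

theorem lower_apply_pow_succ (h : IsLadder Z R L) (n : ℕ) {v : H} (hv : L v = 0) :
    L ((R ^ (n + 1)) v) = -((n : ℂ) + 1) • (R ^ n) ((2 : ℂ) • Z v + (n : ℂ) • v) := by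
  have e : ∀ u, L (R u) = R (L u) - (2 : ℂ) • Z u := by
    intro u
    have := DFunLike.congr_fun h.comm u
    simp only [sub_apply, mul_apply_eq_comp,
      smul_apply] at this
    rw [sub_eq_iff_eq_add] at this
    rw [this]; module
  induction n with
  | zero => simp [e, hv]
  | succ n ih =>
    rw [pow_succ', mul_apply_eq_comp, e, ih, h.weight_apply_pow]
    have r : ∀ u, R ((R ^ n) u) = (R ^ (n + 1)) u := fun u => by
      rw [pow_succ', mul_apply_eq_comp]
    rw [map_smul, r]
    simp only [map_add, map_smul]
    push_cast
    module

/-- Among nonzero vectors killed by `L`, take one killed by the least power `R ^ (n + 1)`. Applying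
`L` to `R ^ (n + 1) w = 0` shows that `R ^ n` kills `2 Z w + n w`, which `L` also kills. Minimality
makes that vector zero, so `w` has the real weight `-n / 2`. -/
theorem exists_lowest_weight [Nontrivial H] (h : IsLadder Z R L) :
    ∃ (w : H) (μ : ℝ), w ≠ 0 ∧ L w = 0 ∧ Z w = (μ : ℂ) • w := by
  classical
  have hR : IsNilpotent R := isNilpotent_of_commutator one_ne_zero (by rw [h.raise, one_smul])
  have hL : IsNilpotent L :=
    isNilpotent_of_commutator (c := -1) (by norm_num) (by rw [h.lower, neg_smul, one_smul])
  obtain ⟨v, hv0, hLv⟩ := exists_ne_zero_apply_eq_zero_of_isNilpotent hL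
  obtain ⟨N, hN⟩ := hR
  have hex : ∃ n : ℕ, ∃ v : H, v ≠ 0 ∧ L v = 0 ∧ (R ^ n) v = 0 :=
    ⟨N, v, hv0, hLv, by rw [hN]; rfl⟩
  obtain ⟨w, hw0, hLw, hRw⟩ := Nat.find_spec hex
  obtain ⟨n, hn⟩ : ∃ n, Nat.find hex = n + 1 := by
    refine Nat.exists_eq_succ_of_ne_zero fun h0 => hw0 ?_
    rw [h0] at hRw
    simpa using hRw
  rw [hn] at hRw
  have hLZ : L (Z w) = 0 := by
    have := DFunLike.congr_fun h.lower w
    simpa [hLw] using this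
  have hlow := h.lower_apply_pow_succ n hLw
  rw [hRw, map_zero] at hlow
  have hn1 : -((n : ℂ) + 1) ≠ 0 := neg_ne_zero.2 (Nat.cast_add_one_ne_zero n)
  have hzero : (R ^ n) ((2 : ℂ) • Z w + (n : ℂ) • w) = 0 :=
    (smul_eq_zero.1 hlow.symm).resolve_left hn1
  have hu : (2 : ℂ) • Z w + (n : ℂ) • w = 0 := by
    by_contra hne
    refine Nat.find_min hex (m := n) (by omega) ⟨_, hne, ?_, hzero⟩
    rw [map_add, map_smul, map_smul, hLZ, hLw, smul_zero, smul_zero, add_zero]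
  refine ⟨w, -(n : ℝ) / 2, hw0, hLw, ?_⟩
  have h2 : (2 : ℂ) • Z w = -((n : ℂ) • w) := eq_neg_of_add_eq_zero_left hu
  calc Z w = (2⁻¹ : ℂ) • (2 : ℂ) • Z w := by rw [smul_smul]; norm_num
    _ = _ := by rw [h2]; push_cast; module

/-- If no proper nonzero closed subspace is invariant under the ladder operators, an operator that
commutes with the raising operator and has weight `n` is a multiple of its `n`-th power. -/
theorem exists_eq_smul_pow [CompleteSpace H] [Nontrivial H] (h : IsLadder Z R L) (hZ : IsSelfAdjoint Z)
    (hirr : ∀ K : Submodule ℂ H, IsClosed (K : Set H) → (∀ x ∈ K, Z x ∈ K) → (∀ x ∈ K, R x ∈ K) →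
      (∀ x ∈ K, L x ∈ K) → K = ⊥ ∨ K = ⊤)
    {T : H →L[ℂ] H} {n : ℕ} (hTR : R * T = T * R) (hTZ : Z * T - T * Z = (n : ℂ) • T) :
    ∃ a : ℂ, T = a • R ^ n := by
  obtain ⟨w, μ, hw0, hLw, hZw⟩ := h.exists_lowest_weight
  have hZp : ∀ k : ℕ, Z ((R ^ k) w) = ((μ + k : ℝ) : ℂ) • (R ^ k) w := by
    intro k
    rw [h.weight_apply_pow, hZw, map_smul]
    push_cast
    module
  set K₀ : Submodule ℂ H := Submodule.span ℂ (Set.range fun k : ℕ => (R ^ k) w) with hK₀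
  have hmem : ∀ k : ℕ, (R ^ k) w ∈ K₀ := fun k => Submodule.subset_span ⟨k, rfl⟩
  have inv : ∀ A : H →L[ℂ] H, (∀ k : ℕ, A ((R ^ k) w) ∈ K₀) →
      ∀ x ∈ K₀.topologicalClosure, A x ∈ K₀.topologicalClosure := by
    intro A hA x hx
    have hle : K₀ ≤ K₀.comap (A : H →ₗ[ℂ] H) := by
      rw [hK₀, Submodule.span_le]
      rintro _ ⟨k, rfl⟩
      exact hA k
    exact map_mem_closure A.continuous hx fun y hy => hle hy
  -- The vectors `R ^ k w` are weight vectors and `L` sends each to a multiple of the previous one,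
  -- so their closed span is invariant.
  have htop : K₀.topologicalClosure = ⊤ := by
    refine (hirr _ K₀.isClosed_topologicalClosure (inv Z fun k => ?_) (inv R fun k => ?_)
      (inv L fun k => ?_)).resolve_left fun hbot => hw0 ?_
    · rw [hZp]; exact K₀.smul_mem _ (hmem k)
    · have := hmem (k + 1)
      rwa [pow_succ', mul_apply_eq_comp] at this
    · cases k with
      | zero => simp [hLw]
      | succ k =>
        rw [h.lower_apply_pow_succ k hLw, hZw]
        have e : (2 : ℂ) • (μ : ℂ) • w + (k : ℂ) • w = ((2 : ℂ) * μ + k) • w := by module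
        rw [e, map_smul]
        exact K₀.smul_mem _ (K₀.smul_mem _ (hmem k))
    · have := K₀.le_topologicalClosure (hmem 0)
      rw [hbot] at this
      simpa using this
  have hdense : Dense (K₀ : Set H) := K₀.dense_iff_topologicalClosure_eq_top.2 htop
  set u := (R ^ n) w with hu
  -- `a • u` is the projection of `T w` onto the line of `u`; if `u = 0`, division by zero gives `a
  -- = 0`, which is harmless.
  set a : ℂ := inner ℂ u (T w) / inner ℂ u u with ha
  set y := T w - a • u with hy
  have hZy : Z y = ((μ + n : ℝ) : ℂ) • y := by
    have e := DFunLike.congr_fun hTZ w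
    simp only [sub_apply, mul_apply_eq_comp, smul_apply, hZw, map_smul] at e
    rw [sub_eq_iff_eq_add] at e
    rw [hy, map_sub, map_smul, hu, hZp, e]
    push_cast
    module
  have horth : ∀ k : ℕ, inner ℂ ((R ^ k) w) y = 0 := by
    intro k
    by_cases hk : k = n
    · subst hk
      rw [← hu, hy, inner_sub_right, inner_smul_right, ha]
      by_cases h0 : u = 0
      · simp [h0]
      · rw [div_mul_cancel₀ _ (inner_self_ne_zero.2 h0), sub_self]
    -- Eigenvectors of the self-adjoint `Z` for the distinct weights `μ + k` and `μ + n` are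
    -- orthogonal.
    · have e : inner ℂ (Z ((R ^ k) w)) y = inner ℂ ((R ^ k) w) (Z y) := hZ.isSymmetric _ _
      rw [hZp, hZy, inner_smul_left, inner_smul_right, Complex.conj_ofReal] at e
      have e' : (((μ + k : ℝ) : ℂ) - ((μ + n : ℝ) : ℂ)) * inner ℂ ((R ^ k) w) y = 0 := by
        rw [sub_mul, e, sub_self]
      refine (mul_eq_zero.1 e').resolve_left fun h0 => hk ?_
      push_cast at h0
      exact_mod_cast (by linear_combination h0 : (k : ℂ) = n)
  have hy0 : y = 0 := by
    refine hdense.eq_zero_of_inner_right (𝕜 := ℂ) fun v hv => ?_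
    have hle : K₀ ≤ (ℂ ∙ y)ᗮ := by
      rw [hK₀, Submodule.span_le]
      rintro _ ⟨k, rfl⟩
      exact Submodule.mem_orthogonal_singleton_iff_inner_left.2 (horth k)
    exact Submodule.mem_orthogonal_singleton_iff_inner_left.1 (hle hv)
  refine ⟨a, ?_⟩
  have hTw : T w = a • (R ^ n) w := sub_eq_zero.1 hy0
  -- Since `T` commutes with `R`, its value at `w` determines it on the whole orbit.
  have heq : Set.EqOn T (a • R ^ n : H →L[ℂ] H) K₀ := by
    refine LinearMap.eqOn_span (f := (T : H →ₗ[ℂ] H)) (g := ((a • R ^ n : H →L[ℂ] H) : H →ₗ[ℂ] H)) ?_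
    rintro _ ⟨k, rfl⟩
    have c : T * R ^ k = R ^ k * T := (Commute.pow_left (show Commute R T from hTR) k).eq.symm
    have c1 := DFunLike.congr_fun c w
    simp only [mul_apply_eq_comp] at c1
    have c2 : R ^ n * R ^ k = R ^ k * R ^ n := (Commute.pow_pow_self R n k).eq
    have c3 := DFunLike.congr_fun c2 w
    simp only [mul_apply_eq_comp] at c3
    simp only [ContinuousLinearMap.coe_coe, smul_apply]
    rw [c1, hTw, map_smul, c3]
  exact DFunLike.coe_injective (Continuous.ext_on hdense T.continuous (map_continuous _) heq)

end IsLadder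

end Ladder

/-! ### Rank-two tensors under rotations -/

section Tensor

variable {A : Type*} [Ring A] [Algebra ℂ A] {J : Fin 3 → A} {X Y : Fin 3 → Fin 3 → A}

/-- The operators `J i` satisfy the commutation relations of spin components. -/
def IsSpin (J : Fin 3 → A) : Prop :=
  ∀ k i, J k * J i - J i * J k = ∑ m, (Complex.I * eps k i m) • J m

/-- The operators `X i l` transform as a tensor of rank two under rotations generated by `J`. -/
def IsTensor (J : Fin 3 → A) (X : Fin 3 → Fin 3 → A) : Prop :=
  ∀ k i l, J k * X i l - X i l * J k =
    ∑ m, ((Complex.I * eps k i m) • X m l + (Complex.I * eps k l m) • X i m)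

theorem IsSpin.isTensor_mul (h : IsSpin J) : IsTensor J fun i l => J i * J l := by
  intro k i l
  have e : J k * (J i * J l) - J i * J l * J k
      = (J k * J i - J i * J k) * J l + J i * (J k * J l - J l * J k) := by noncomm_ring
  rw [e, h, h, Finset.sum_mul, Finset.mul_sum, ← Finset.sum_add_distrib]
  simp only [smul_mul_assoc, mul_smul_comm]

theorem IsTensor.swap (h : IsTensor J X) : IsTensor J fun i l => X l i := by
  intro k i l
  rw [h]
  exact Finset.sum_congr rfl fun _ _ => add_comm _ _

theorem IsTensor.add (hX : IsTensor J X) (hY : IsTensor J Y) :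
    IsTensor J fun i l => X i l + Y i l := by
  intro k i l
  have e : J k * (X i l + Y i l) - (X i l + Y i l) * J k
      = (J k * X i l - X i l * J k) + (J k * Y i l - Y i l * J k) := by noncomm_ring
  rw [e, hX, hY, ← Finset.sum_add_distrib]
  refine Finset.sum_congr rfl fun _ _ => ?_
  module

theorem IsTensor.const_smul (c : ℂ) (hX : IsTensor J X) : IsTensor J fun i l => c • X i l := by
  intro k i l
  rw [mul_smul_comm, smul_mul_assoc, ← smul_sub, hX, Finset.smul_sum]
  refine Finset.sum_congr rfl fun _ _ => ?_
  module

/-- The trace is rotation invariant, by antisymmetry of `eps`. Applied to `J i * J l`, this says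
that the Casimir operator commutes with every `J k`. -/
theorem IsTensor.commutator_trace (h : IsTensor J X) (k : Fin 3) :
    J k * ∑ i, X i i - (∑ i, X i i) * J k = 0 := by
  rw [Finset.mul_sum, Finset.sum_mul, ← Finset.sum_sub_distrib]
  simp only [h k, Fin.sum_univ_three]
  fin_cases k <;> simp [eps]

/-- A symmetric tensor whose highest weight component vanishes is a multiple of the identity. -/
theorem IsTensor.eq_zero_of_highest (h : IsTensor J X) (hs : ∀ i l, X i l = X l i)
    (h0 : X 0 0 - X 1 1 + (2 * Complex.I) • X 0 1 = 0) :
    (∀ i l, i ≠ l → X i l = 0) ∧ ∀ i l, X i i = X l l := by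
  have D : ∀ k i l, J k * X i l = X i l * J k + ∑ m, ((Complex.I * eps k i m) • X m l
      + (Complex.I * eps k l m) • X i m) := fun k i l => by rw [← h k i l]; abel
  have c0 : ∀ {x : A} (k : Fin 3), x = 0 → J k * x - x * J k = 0 := by
    rintro x k rfl; simp
  have s10 := hs 1 0
  have s20 := hs 2 0
  have s21 := hs 2 1
  -- Commutators of a vanishing component with the `J k` vanish too, and they generate the remaining
  -- components: `e1` has weight 1, and `e2` mixes weights 2 and 0, so that removing `h0` leaves the
  -- weight 0 component `e3`.
  have e1 : X 0 2 + Complex.I • X 1 2 = 0 := by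
    have := c0 0 h0
    simp only [mul_add, add_mul, mul_sub, sub_mul, mul_smul_comm, smul_mul_assoc, D,
      Fin.sum_univ_three] at this
    simp [eps, s10, s20, s21] at this
    linear_combination (norm := skip) (-1 / 2 : ℂ) • this
    match_scalars <;> grind [Complex.I_sq]
  have e2 : X 2 2 - X 1 1 + Complex.I • X 0 1 = 0 := by
    have := c0 0 e1
    simp only [mul_add, add_mul, mul_smul_comm, smul_mul_assoc, D,
      Fin.sum_univ_three] at this
    simp [eps, s10] at this
    linear_combination (norm := skip) (-1 : ℂ) • this
    match_scalars <;> grind [Complex.I_sq]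
  have e3 : X 0 0 + X 1 1 - (2 : ℂ) • X 2 2 = 0 := by
    linear_combination (norm := module) h0 - (2 : ℂ) • e2
  have e4 : X 1 2 = 0 := by
    have := c0 0 e3
    simp only [mul_add, add_mul, mul_sub, sub_mul, mul_smul_comm, smul_mul_assoc, D,
      Fin.sum_univ_three] at this
    simp [eps, s10, s20, s21] at this
    linear_combination (norm := skip) (-Complex.I / 6) • this
    match_scalars <;> grind [Complex.I_sq]
  have e5 : X 0 2 = 0 := by rwa [e4, smul_zero, add_zero] at e1
  have e6 : X 0 1 = 0 := by
    have := c0 1 e4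
    simp only [D, Fin.sum_univ_three] at this
    simp [eps, s10] at this
    exact this
  rw [e6, smul_zero, add_zero] at h0 e2
  have d01 := sub_eq_zero.1 h0
  have d21 := sub_eq_zero.1 e2
  constructor
  · intro i l hil
    fin_cases i <;> fin_cases l <;> first | exact absurd rfl hil | simp [s10, s20, s21, e4, e5, e6]
  · intro i l
    fin_cases i <;> fin_cases l <;> simp [d01, d21]

/-- The component is `X` contracted twice with the null vector `(1, i, 0)`. It has the top weight 2
of a rank-two tensor, so nothing lies above it for the raising operator to reach. -/
theorem IsTensor.raise_highest (h : IsTensor J X) (hs : ∀ i l, X i l = X l i) :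
    (J 0 + Complex.I • J 1) * (X 0 0 - X 1 1 + (2 * Complex.I) • X 0 1) =
      (X 0 0 - X 1 1 + (2 * Complex.I) • X 0 1) * (J 0 + Complex.I • J 1) := by
  have D : ∀ k i l, J k * X i l = X i l * J k + ∑ m, ((Complex.I * eps k i m) • X m l
      + (Complex.I * eps k l m) • X i m) := fun k i l => by rw [← h k i l]; abel
  simp only [mul_add, add_mul, mul_sub, sub_mul, mul_smul_comm, smul_mul_assoc, D,
      Fin.sum_univ_three]
  simp [eps, hs 1 0, hs 2 0, hs 2 1]
  match_scalars <;> grind [Complex.I_sq]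

theorem IsTensor.weight_highest (h : IsTensor J X) (hs : ∀ i l, X i l = X l i) :
    J 2 * (X 0 0 - X 1 1 + (2 * Complex.I) • X 0 1) -
      (X 0 0 - X 1 1 + (2 * Complex.I) • X 0 1) * J 2 =
      (2 : ℂ) • (X 0 0 - X 1 1 + (2 * Complex.I) • X 0 1) := by
  have D : ∀ k i l, J k * X i l = X i l * J k + ∑ m, ((Complex.I * eps k i m) • X m l
      + (Complex.I * eps k l m) • X i m) := fun k i l => by rw [← h k i l]; abel
  simp only [mul_add, add_mul, mul_sub, sub_mul, mul_smul_comm, smul_mul_assoc, D,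
      Fin.sum_univ_three]
  simp [eps, hs 1 0, hs 2 0, hs 2 1]
  match_scalars <;> grind [Complex.I_sq]

end Tensor

theorem IsSpin.isLadder {H : Type*} [NormedAddCommGroup H] [InnerProductSpace ℂ H]
    {J : Fin 3 → H →L[ℂ] H} (h : IsSpin J) :
    IsLadder (J 2) (J 0 + Complex.I • J 1) (J 0 - Complex.I • J 1) := by
  have h01 : J 0 * J 1 = J 1 * J 0 + Complex.I • J 2 := by
    have := h 0 1
    simp [Fin.sum_univ_three, eps] at this
    rw [← this]; abel
  have h20 : J 2 * J 0 = J 0 * J 2 + Complex.I • J 1 := by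
    have := h 2 0
    simp [Fin.sum_univ_three, eps] at this
    rw [← this]; abel
  have h12 : J 1 * J 2 = J 2 * J 1 + Complex.I • J 0 := by
    have := h 1 2
    simp [Fin.sum_univ_three, eps] at this
    rw [← this]; abel
  constructor
  · simp only [mul_add, add_mul, mul_smul_comm, smul_mul_assoc, h20, h12]
    match_scalars <;> grind [Complex.I_sq]
  · simp only [mul_sub, sub_mul, mul_smul_comm, smul_mul_assoc, h20, h12]
    match_scalars <;> grind [Complex.I_sq]
  · simp only [mul_sub, sub_mul, mul_add, add_mul, mul_smul_comm, smul_mul_assoc, h01]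
    match_scalars <;> grind [Complex.I_sq]

/-! ### Poisson brackets and relations on the sphere -/

theorem poisson_S_S {s : ℝ} (k i : Fin 3) :
    poisson (S k : Poly s) (S i) = ∑ m, eps k i m • S m := by
  have e : preBracket (X k) (X i) = ∑ m, eps k i m • (X m : MvPolynomial (Fin 3) ℝ) := by
    rw [preBracket_eq]
    fin_cases k <;> fin_cases i <;> simp [eps, pderiv_X]
  simp only [S]
  rw [poisson_mk, e, map_sum]
  rfl

theorem poisson_S_mul {s : ℝ} (k i l : Fin 3) :
    poisson (S k : Poly s) (S i * S l) =
      ∑ m, (eps k i m • (S m * S l) + eps k l m • (S i * S m)) := by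
  have e : preBracket (X k) (X i * X l) = ∑ m, (eps k i m • (X m * X l) +
      eps k l m • (X i * X m : MvPolynomial (Fin 3) ℝ)) := by
    rw [preBracket_eq]
    fin_cases k <;> fin_cases i <;> fin_cases l <;>
      simp [Fin.sum_univ_three, eps, pderiv_X] <;> ring
  simp only [S]
  rw [← map_mul, poisson_mk, e, map_sum]
  rfl

theorem sum_S_sq (s : ℝ) : ∑ i, (S i : Poly s) * S i = (s ^ 2) • (1 : Poly s) := by
  have h : Ideal.Quotient.mk (sphereIdeal s) (∑ i, X i ^ 2) =
      Ideal.Quotient.mk (sphereIdeal s) (C (s ^ 2)) :=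
    Ideal.Quotient.eq.2 (Ideal.mem_span_singleton_self _)
  rw [map_sum] at h
  simp only [S, ← sq, ← map_pow]
  rw [h, ← Algebra.algebraMap_eq_smul_one]
  rfl

theorem degLE_one_le (s : ℝ) :
    degLE s 1 ≤ Submodule.span ℝ (insert 1 (Set.range (S : Fin 3 → Poly s))) := by
  rw [degLE, Submodule.map_le_iff_le_comap]
  intro p hp
  rw [mem_restrictTotalDegree] at hp
  rw [Submodule.mem_comap, p.as_sum, map_sum]
  refine Submodule.sum_mem _ fun d hd => ?_
  have hd1 : d.degree ≤ 1 := (le_totalDegree hd).trans hp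
  have hm : monomial d (coeff d p) = coeff d p • monomial d (1 : ℝ) := by
    rw [smul_monomial, smul_eq_mul, mul_one]
  rw [hm, map_smul]
  refine Submodule.smul_mem _ _ (Submodule.subset_span ?_)
  rcases Nat.le_one_iff_eq_zero_or_eq_one.1 hd1 with h0 | h1
  · rw [Finsupp.degree_eq_zero_iff] at h0
    subst h0
    exact Or.inl (map_one (Ideal.Quotient.mk (sphereIdeal s)))
  · obtain ⟨i, rfl⟩ := (Finsupp.range_single_one).ge h1
    exact Or.inr ⟨i, rfl⟩

/-- Taking adjoints gives the same equation with the conjugate coefficient; the average of the two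
has coefficient `a.re`. This also covers `y = 0`, where `a` is arbitrary. -/
theorem eq_re_smul_of_isSelfAdjoint {A : Type*} [AddCommGroup A] [Module ℂ A] [StarAddMonoid A]
    [StarModule ℂ A] {x y : A} {a : ℂ} (hx : IsSelfAdjoint x) (hy : IsSelfAdjoint y)
    (h : x = a • y) : x = (a.re : ℂ) • y := by
  have h' : x = star a • y := by
    rw [← hx.star_eq, h, star_smul, hy.star_eq]
  have e : (2 : ℂ) • x = (a + star a) • y := by
    rw [add_smul, ← h, ← h', two_smul]
  have e2 : a + star a = 2 * (a.re : ℂ) := by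
    rw [Complex.star_def, Complex.add_conj]; push_cast; ring
  rw [e2, mul_smul] at e
  exact smul_right_injective A (two_ne_zero (α := ℂ)) e

/-! ### Quantizations as spin representations -/

section Quantization

variable {s : ℝ} {H : Type*} [NormedAddCommGroup H] [InnerProductSpace ℂ H] [CompleteSpace H]
  {Q : Poly s →ₗ[ℝ] (H →L[ℂ] H)}

theorem IsQuantization.commutator (h : IsQuantization Q) (f g : Poly s) :
    Q f * Q g - Q g * Q f = Complex.I • Q (poisson f g) := by
  rw [h.map_poisson, smul_smul]
  simp

theorem IsQuantization.isSpin (h : IsQuantization Q) : IsSpin fun i => Q (S i) := by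
  intro k i
  rw [h.commutator, poisson_S_S, map_sum, Finset.smul_sum]
  refine Finset.sum_congr rfl fun m _ => ?_
  rw [map_smul, mul_smul, Complex.coe_smul]

theorem IsQuantization.isTensor (h : IsQuantization Q) :
    IsTensor (fun i => Q (S i)) fun i l => Q (S i * S l) := by
  intro k i l
  rw [h.commutator, poisson_S_mul, map_sum, Finset.smul_sum]
  refine Finset.sum_congr rfl fun m _ => ?_
  rw [map_add, map_smul, map_smul, mul_smul, mul_smul, Complex.coe_smul, Complex.coe_smul,
    smul_add]

/-- The first two spin components are complex combinations of the raising and lowering operators, so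
ladder invariance implies invariance under all of degree at most one. -/
theorem IsAdmissibleQuantization.eq_bot_or_eq_top_of_ladder
    (h : IsAdmissibleQuantization Q (degLE s 1)) (K : Submodule ℂ H) (hK : IsClosed (K : Set H))
    (hZ : ∀ x ∈ K, Q (S 2) x ∈ K) (hR : ∀ x ∈ K, (Q (S 0) + Complex.I • Q (S 1)) x ∈ K)
    (hL : ∀ x ∈ K, (Q (S 0) - Complex.I • Q (S 1)) x ∈ K) : K = ⊥ ∨ K = ⊤ := by
  refine h.eq_bot_or_eq_top K hK fun f hf x hx => ?_
  have h0 : Q (S 0) x ∈ K := by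
    have := K.smul_mem (2⁻¹ : ℂ) (K.add_mem (hR x hx) (hL x hx))
    convert this using 1
    simp only [add_apply, sub_apply, smul_apply]
    module
  have h1 : Q (S 1) x ∈ K := by
    have := K.smul_mem (-Complex.I / 2) (K.sub_mem (hR x hx) (hL x hx))
    convert this using 1
    simp only [add_apply, sub_apply, smul_apply]
    match_scalars <;> grind [Complex.I_sq]
  refine Submodule.span_induction (p := fun g _ => Q g x ∈ K) ?_ ?_ ?_ ?_ (degLE_one_le s hf)
  · rintro g (rfl | ⟨i, rfl⟩)
    · rw [h.map_one]; exact hx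
    · fin_cases i
      exacts [h0, h1, hZ x hx]
  · simp
  · intro f g _ _ hf hg
    rw [map_add]; exact K.add_mem hf hg
  · intro r f _ hf
    rw [map_smul]
    have := K.smul_mem (r : ℂ) hf
    rwa [Complex.coe_smul] at this

end Quantization

end SpinSphere

/-! ### The quantization of quadratic polynomials -/

theorem proposition2 (s : ℝ) (hs : 0 < s)
    {H : Type*} [NormedAddCommGroup H] [InnerProductSpace ℂ H] [CompleteSpace H]
    (Q : SpinSphere.Poly s →ₗ[ℝ] (H →L[ℂ] H))
    (hQ : SpinSphere.IsAdmissibleQuantization Q (SpinSphere.degLE s 1)) :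
    ∃ a c : ℝ, a ^ 2 + c ^ 2 ≠ 0 ∧
      (∀ i : Fin 3,
        Q (SpinSphere.S i ^ 2) = a • Q (SpinSphere.S i) ^ 2 + c • (1 : H →L[ℂ] H)) ∧
      (∀ i l : Fin 3, i ≠ l →
        Q (SpinSphere.S i * SpinSphere.S l) =
          (a / 2) • (Q (SpinSphere.S i) * Q (SpinSphere.S l)
            + Q (SpinSphere.S l) * Q (SpinSphere.S i))) := by
  open SpinSphere in
  have : Nontrivial H := hQ.nontrivial
  have hspin := hQ.toIsQuantization.isSpin
  have htensor := hQ.toIsQuantization.isTensor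
  have hsa := hQ.isSelfAdjoint
  set J : Fin 3 → H →L[ℂ] H := fun i => Q (S i) with hJ
  set P : Fin 3 → Fin 3 → H →L[ℂ] H := fun i l => Q (S i * S l) with hP
  have hJsa : ∀ i, IsSelfAdjoint (J i) := fun i => hsa _
  have hPs : ∀ i l, P i l = P l i := fun i l => by simp only [hP, mul_comm]
  have hladder := hspin.isLadder
  -- With `n = 0` this is Schur's lemma for the Casimir operator.
  obtain ⟨κ, hκ⟩ := hladder.exists_eq_smul_pow (hJsa 2) hQ.eq_bot_or_eq_top_of_ladder
    (T := ∑ i, J i * J i) (n := 0) (by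
      have c0 := sub_eq_zero.1 (hspin.isTensor_mul.commutator_trace 0)
      have c1 := sub_eq_zero.1 (hspin.isTensor_mul.commutator_trace 1)
      rw [add_mul, mul_add, smul_mul_assoc, mul_smul_comm, c0, c1]) (by
      rw [Nat.cast_zero, zero_smul]
      exact hspin.isTensor_mul.commutator_trace 2)
  obtain ⟨a, ha⟩ := hladder.exists_eq_smul_pow (hJsa 2) hQ.eq_bot_or_eq_top_of_ladder (n := 2)
    (htensor.raise_highest hPs) (by
      rw [Nat.cast_ofNat]
      exact htensor.weight_highest hPs)
  rw [pow_zero] at hκ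
  -- The highest component of `J i * J l + J l * J i` is `2 • R ^ 2`, with `R` the raising operator;
  -- hence the factor `a / 2`.
  obtain ⟨hoff, hdiag⟩ := (htensor.add
      ((hspin.isTensor_mul.add hspin.isTensor_mul.swap).const_smul (-(a / 2)))).eq_zero_of_highest
    (fun i l => by simp only [hPs i l, add_comm (J i * J l)]) (by
      rw [pow_two] at ha
      simp only [mul_add, add_mul, mul_smul_comm, smul_mul_assoc] at ha
      linear_combination (norm := skip) ha
      match_scalars <;> grind [Complex.I_sq])
  have hsq : ∀ i, IsSelfAdjoint (J i * J i) := fun i => by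
    rw [← pow_two]; exact (hJsa i).pow 2
  have hκ' : ∑ i, J i * J i = (κ.re : ℂ) • (1 : H →L[ℂ] H) :=
    eq_re_smul_of_isSelfAdjoint (isSelfAdjoint_sum _ fun i _ => hsq i) (.one _) hκ
  have hoff' : ∀ i l, i ≠ l → P i l = (((a / 2).re : ℝ) : ℂ) • (J i * J l + J l * J i) := by
    intro i l hil
    refine eq_re_smul_of_isSelfAdjoint (hsa _) ?_ ?_
    · rw [IsSelfAdjoint, star_add, star_mul, star_mul, (hJsa i).star_eq, (hJsa l).star_eq, add_comm]
    · linear_combination (norm := module) hoff i l hil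
  have hdiag' : ∀ i l, P i i - P l l = (a.re : ℂ) • (J i * J i - J l * J l) := by
    intro i l
    refine eq_re_smul_of_isSelfAdjoint ((hsa _).sub (hsa _)) ((hsq i).sub (hsq l)) ?_
    linear_combination (norm := module) hdiag i l
  have htrace : ∑ i, P i i = ((s ^ 2 : ℝ) : ℂ) • (1 : H →L[ℂ] H) := by
    rw [hP, ← map_sum, sum_S_sq, map_smul, hQ.map_one, Complex.coe_smul]
  -- Averaging `hdiag' i l` over the three values of `l` brings in both traces, `s ^ 2` and `κ.re`,
  -- each divided by 3.
  have hmain : ∀ i, P i i = a.re • J i ^ 2 + ((s ^ 2 - a.re * κ.re) / 3) • (1 : H →L[ℂ] H) := by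
    intro i
    have d0 := hdiag' i 0
    have d1 := hdiag' i 1
    have d2 := hdiag' i 2
    rw [Fin.sum_univ_three] at htrace hκ'
    rw [← Complex.coe_smul, ← Complex.coe_smul, pow_two]
    push_cast at htrace ⊢
    linear_combination (norm := module) (1 / 3 : ℂ) • d0 + (1 / 3 : ℂ) • d1 + (1 / 3 : ℂ) • d2
      + (1 / 3 : ℂ) • htrace - ((a.re : ℂ) / 3) • hκ'
  refine ⟨a.re, (s ^ 2 - a.re * κ.re) / 3, fun h0 => ?_, fun i => ?_, fun i l hil => ?_⟩
  -- If both constants vanished, the second would reduce to `s ^ 2 / 3 = 0`, contradicting `0 < s`.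
  · have ha0 : a.re = 0 := by nlinarith [sq_nonneg a.re, sq_nonneg ((s ^ 2 - a.re * κ.re) / 3)]
    rw [ha0] at h0
    have : 0 < s ^ 2 := by positivity
    nlinarith
  · rw [pow_two]; exact hmain i
  · have := hoff' i l hil
    rw [Complex.coe_smul, Complex.div_ofNat_re] at this
    exact this
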